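/- **Proposition 1.1.** Let $(B_1,g_{B_1})$, $(B_2,g_{B_2})$ and $(F,g_F)$ be finite-dimensional smooth semi-Riemannian manifolds without boundary, and let $d=\dim F$. Let $B=B_1\times B_2$ carry the product metric $g_B=g_{B_1}+g_{B_2}$, and let $f:B\to(0,\infty)$ be a smooth function of the form $f(x,y)=f_1(x)+f_2(y)$ with $f_i:B_i\to\mathbb R$. Let $M=B\times_f F$ be the warped product, i.e. $B\times F$ with the metric $g_M=g_B+f^2g_F$. For $i=1,2$ let $\mathrm{Hess}_i$, $\Delta_i=\operatorname{tr}_{g_{B_i}}\mathrm{Hess}_i$ and $\nabla_i$ be the Hessian, Laplacian and gradient of $(B_i,g_{B_i})$; let $\mathrm{Hess}$, $\Delta$, $\nabla$ be those of $(B,g_B)$, and write $|\nabla f|^2=g_B(\nabla f,\nabla f)$ and $|\nabla_if_i|^2=g_{B_i}(\nabla_if_i,\nabla_if_i)$. Assume that $\mathrm{Hess}_2(f_2)=0$. Then, with $\tau_i:B\to B_i$ the projections, $$\mathrm{Hess}(f)=\tau_1^*\mathrm{Hess}_1(f_1)+\tau_2^*\mathrm{Hess}_2(f_2),\qquad |\nabla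 f|^2=|\nabla_1f_1|^2+|\nabla_2f_2|^2,\qquad \Delta f=\Delta_1f_1+\Delta_2f_2,\qquad \Delta_2f_2=0,$$ and for all vectors $X,X'$ tangent to $B_1$, $Y,Y'$ tangent to $B_2$ and $U,U'$ tangent to $F$ (identified with their lifts to $M$) the Ricci tensor of $M$, with the sign convention in which round spheres have positive Ricci curvature, satisfies $$\begin{aligned} \mathrm{Ric}_M(X,X')&=\mathrm{Ric}_{B_1}(X,X')-\frac df\,\mathrm{Hess}_1(f_1)(X,X'),\\ \mathrm{Ric}_M(Y,Y')&=\mathrm{Ric}_{B_2}(Y,Y'),\\ \mathrm{Ric}_M(U,U')&=\mathrm{Ric}_F(U,U')-g_M(U,U')\left(\frac{\Delta_1f_1}{f}+(d-1)\frac{|\nabla f|^2}{f^2}\right),\qquad g_M(U,U')=f^2g_F(U,U'), \end{aligned}$$ and all mixed terms vanish: $\mathrm{Ric}_M(X,Y)=\mathrm{Ric}_M(X,U)=\mathrm{Ric}_M(Y,U)=0$, and likewise with the two arguments exchanged. -/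

import Mathlib

set_option maxSynthPendingDepth 3
set_option linter.unusedSectionVars false

open scoped Manifold ContDiff

noncomputable section

namespace SemiRiem

section Local

/-! ### Local formulas in an open subset of a finite-dimensional vector space

Here `G : E → (E →L[ℝ] E →L[ℝ] ℝ)` plays the role of the matrix `z ↦ (g_ij(z))` of a metric in a
chart, written without choosing a basis of the model space `E`. -/

variable {E : Type*} [NormedAddCommGroup E] [NormedSpace ℝ E]

/-- The inverse of the isomorphism `v ↦ ⟨v, ·⟩` from vectors to covectors given by a nondegenerate
bilinear form (the matrix `g^ij`). -/
def sharp (b : E →L[ℝ] E →L[ℝ] ℝ) : (E →L[ℝ] ℝ) →L[ℝ] E :=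
  ContinuousLinearMap.inverse b

/-- Christoffel symbols of the first kind (times two):
`(u, v, w) ↦ ∂_u G(v, w) + ∂_v G(u, w) - ∂_w G(u, v)`; see `christoffelFirst_apply`. -/
def christoffelFirst (G : E → (E →L[ℝ] E →L[ℝ] ℝ)) (z : E) : E →L[ℝ] E →L[ℝ] E →L[ℝ] ℝ :=
  fderiv ℝ G z + (fderiv ℝ G z).flip -
    ((ContinuousLinearMap.flipₗᵢ ℝ E E ℝ).toContinuousLinearEquiv.toContinuousLinearMap ∘L
      (fderiv ℝ G z).flip : E →L[ℝ] E →L[ℝ] E →L[ℝ] ℝ)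

theorem christoffelFirst_apply (G : E → (E →L[ℝ] E →L[ℝ] ℝ)) (z u v w : E) :
    christoffelFirst G z u v w =
      fderiv ℝ G z u v w + fderiv ℝ G z v u w - fderiv ℝ G z w u v := by
  simp [christoffelFirst]

/-- Christoffel symbols of the second kind, `Γ^k_ij = ½ g^kl (∂_i g_jl + ∂_j g_il - ∂_l g_ij)`,
as a bilinear map `E × E → E` depending on the point `z`; see `christoffel_apply`. -/
def christoffel (G : E → (E →L[ℝ] E →L[ℝ] ℝ)) (z : E) : E →L[ℝ] E →L[ℝ] E :=
  (2⁻¹ : ℝ) • (ContinuousLinearMap.compL ℝ E (E →L[ℝ] ℝ) E (sharp (G z))) ∘L christoffelFirst G z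

theorem christoffel_apply (G : E → (E →L[ℝ] E →L[ℝ] ℝ)) (z u v : E) :
    christoffel G z u v = (2⁻¹ : ℝ) • sharp (G z) (christoffelFirst G z u v) := by
  simp [christoffel]

/-- The endomorphism `u ↦ R(u, v) w`, where
`R(u, v) w = ∇_u ∇_v w - ∇_v ∇_u w - ∇_[u,v] w` is the Riemann curvature tensor of the Levi-Civita
connection; in coordinates
`R(u, v) w = (∂_u Γ)(v, w) - (∂_v Γ)(u, w) + Γ(u, Γ(v, w)) - Γ(v, Γ(u, w))`;
see `curvature_apply`. -/
def curvature (G : E → (E →L[ℝ] E →L[ℝ] ℝ)) (z v w : E) : E →L[ℝ] E :=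
  ((fderiv ℝ (christoffel G) z).flip v).flip w - (fderiv ℝ (christoffel G) z v).flip w +
    (christoffel G z).flip (christoffel G z v w) -
    christoffel G z v ∘L (christoffel G z).flip w

theorem curvature_apply (G : E → (E →L[ℝ] E →L[ℝ] ℝ)) (z u v w : E) :
    curvature G z v w u =
      fderiv ℝ (christoffel G) z u v w - fderiv ℝ (christoffel G) z v u w +
        christoffel G z u (christoffel G z v w) - christoffel G z v (christoffel G z u w) := by
  simp [curvature]

/-- The Ricci tensor `Ric(v, w) = tr (u ↦ R(u, v) w)` in coordinates. -/
def localRicci (G : E → (E →L[ℝ] E →L[ℝ] ℝ)) (z v w : E) : ℝ :=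
  LinearMap.trace ℝ E (curvature G z v w).toLinearMap

/-- The Hessian `Hess f (u, v) = ∂_u ∂_v f - Γ(u, v) f` in coordinates; see `localHess_apply`. -/
def localHess (G : E → (E →L[ℝ] E →L[ℝ] ℝ)) (f : E → ℝ) (z : E) : E →L[ℝ] E →L[ℝ] ℝ :=
  fderiv ℝ (fderiv ℝ f) z -
    (ContinuousLinearMap.compL ℝ E E ℝ (fderiv ℝ f z)) ∘L christoffel G z

theorem localHess_apply (G : E → (E →L[ℝ] E →L[ℝ] ℝ)) (f : E → ℝ) (z u v : E) :
    localHess G f z u v =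
      fderiv ℝ (fderiv ℝ f) z u v - fderiv ℝ f z (christoffel G z u v) := by
  simp [localHess]

end Local

section Manifold

variable {E : Type*} [NormedAddCommGroup E] [NormedSpace ℝ E]
  {H : Type*} [TopologicalSpace H] (I : ModelWithCorners ℝ E H)
  {M : Type*} [TopologicalSpace M] [ChartedSpace H M]

/-- The derivative at `z` of the inverse of the preferred chart around `p`: it sends a vector of the
model space to the tangent vector at the point with coordinates `z` whose components in this chart
are the given ones. -/
def chartSymmDeriv (p : M) (z : E) : E →L[ℝ] TangentSpace I ((extChartAt I p).symm z) :=
  mfderiv 𝓘(ℝ, E) I (extChartAt I p).symm z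

/-- The components, in the preferred chart around `p`, of a field `g` of bilinear forms on the
tangent spaces: the pullback of `g` under the inverse of the chart. -/
def chartRep (g : ∀ x : M, TangentSpace I x →L[ℝ] TangentSpace I x →L[ℝ] ℝ) (p : M) (z : E) :
    E →L[ℝ] E →L[ℝ] ℝ :=
  ContinuousLinearMap.bilinearComp (E := E) (F := E) (g ((extChartAt I p).symm z))
    (chartSymmDeriv I p z) (chartSymmDeriv I p z)

theorem chartRep_apply (g : ∀ x : M, TangentSpace I x →L[ℝ] TangentSpace I x →L[ℝ] ℝ) (p : M)
    (z u v : E) :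
    chartRep I g p z u v =
      g ((extChartAt I p).symm z) (chartSymmDeriv I p z u) (chartSymmDeriv I p z v) := rfl

variable (M) in
/-- A semi-Riemannian (pseudo-Riemannian) metric on a manifold: a symmetric nondegenerate bilinear
form on each tangent space, whose components in the charts `extChartAt I p`, which form an atlas,
are smooth. -/
structure Metric where
  /-- The bilinear form on the tangent space at `x`. -/
  val : ∀ x : M, TangentSpace I x →L[ℝ] TangentSpace I x →L[ℝ] ℝ
  symm : ∀ (x : M) (v w : TangentSpace I x), val x v w = val x w v
  nondegenerate : ∀ (x : M) (v : TangentSpace I x), (∀ w : TangentSpace I x, val x v w = 0) → v = 0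
  smooth : ∀ p : M, ContDiffOn ℝ ∞ (chartRep I val p) (extChartAt I p).target

variable {I}

namespace Metric

/-- The Ricci tensor at `p`, computed in the preferred chart around `p`. This is the chart through
which `TangentSpace I p` is identified with the model space `E`, so that no change of coordinates
is needed for the arguments. -/
def ricci (g : Metric I M) (p : M) (v w : TangentSpace I p) : ℝ :=
  localRicci (chartRep I g.val p) (extChartAt I p p) v w

/-- The Hessian of a function at `p`, computed in the preferred chart around `p`. -/
def hess (g : Metric I M) (f : M → ℝ) (p : M) :
    TangentSpace I p →L[ℝ] TangentSpace I p →L[ℝ] ℝ :=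
  localHess (E := E) (chartRep I g.val p) (f ∘ (extChartAt I p).symm) (extChartAt I p p)

/-- The vector metrically dual to a covector at `p`. -/
def sharpAt (g : Metric I M) (p : M) :
    (TangentSpace I p →L[ℝ] ℝ) →L[ℝ] TangentSpace I p :=
  sharp (E := E) (g.val p)

/-- The gradient of a function: the vector dual to its differential. -/
def grad (g : Metric I M) (f : M → ℝ) (p : M) : TangentSpace I p :=
  g.sharpAt p (mfderiv I 𝓘(ℝ, ℝ) f p)

/-- `|∇f|² = ⟨∇f, ∇f⟩` (a number of any sign if the metric is indefinite). -/
def normSqGrad (g : Metric I M) (f : M → ℝ) (p : M) : ℝ :=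
  g.val p (g.grad f p) (g.grad f p)

/-- The Laplacian: the trace of the Hessian with respect to the metric. -/
def laplacian (g : Metric I M) (f : M → ℝ) (p : M) : ℝ :=
  LinearMap.trace ℝ (TangentSpace I p) (g.sharpAt p ∘L g.hess f p).toLinearMap

end Metric

end Manifold

section Warped

variable {E : Type*} [NormedAddCommGroup E] [NormedSpace ℝ E]
  {H : Type*} [TopologicalSpace H] {I : ModelWithCorners ℝ E H}
  {B : Type*} [TopologicalSpace B] [ChartedSpace H B]
  {E' : Type*} [NormedAddCommGroup E'] [NormedSpace ℝ E']
  {H' : Type*} [TopologicalSpace H'] {J : ModelWithCorners ℝ E' H'}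
  {F : Type*} [TopologicalSpace F] [ChartedSpace H' F]

/-- The bilinear form `τ^* g_B + f² σ^* g_F` on the tangent spaces of `B × F`, where `τ` and `σ` are
the projections to `B` and `F`. The tangent space of the product at `(x, q)` is the product of the
tangent spaces, and `dτ`, `dσ` are its two projections. -/
def warpedVal (gB : ∀ x : B, TangentSpace I x →L[ℝ] TangentSpace I x →L[ℝ] ℝ)
    (gF : ∀ q : F, TangentSpace J q →L[ℝ] TangentSpace J q →L[ℝ] ℝ) (f : B → ℝ) (p : B × F) :
    TangentSpace (I.prod J) p →L[ℝ] TangentSpace (I.prod J) p →L[ℝ] ℝ :=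
  ContinuousLinearMap.bilinearComp (E := E) (F := E) (gB p.1)
      (ContinuousLinearMap.fst ℝ E E') (ContinuousLinearMap.fst ℝ E E') +
    (f p.1) ^ 2 • ContinuousLinearMap.bilinearComp (E := E') (F := E') (gF p.2)
      (ContinuousLinearMap.snd ℝ E E') (ContinuousLinearMap.snd ℝ E E')

theorem warpedVal_apply (gB : ∀ x : B, TangentSpace I x →L[ℝ] TangentSpace I x →L[ℝ] ℝ)
    (gF : ∀ q : F, TangentSpace J q →L[ℝ] TangentSpace J q →L[ℝ] ℝ) (f : B → ℝ) (p : B × F)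
    (v w : E × E') :
    warpedVal gB gF f p v w = gB p.1 v.1 w.1 + (f p.1) ^ 2 * gF p.2 v.2 w.2 := rfl

theorem mdifferentiableAt_chart_symm [I.Boundaryless] [IsManifold I ∞ B] (p : B) {z : E}
    (hz : z ∈ (extChartAt I p).target) :
    MDifferentiableAt 𝓘(ℝ, E) I (extChartAt I p).symm z := by
  have : IsManifold I 1 B := IsManifold.of_le (n := ∞) (by simp)
  have h := mdifferentiableWithinAt_extChartAt_symm hz
  rwa [I.range_eq_univ, mdifferentiableWithinAt_univ] at h

theorem chart_target_prod (p : B × F) {z : E × E'}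
    (hz : z ∈ (extChartAt (I.prod J) p).target) :
    z.1 ∈ (extChartAt I p.1).target ∧ z.2 ∈ (extChartAt J p.2).target := by
  rw [extChartAt_prod] at hz
  exact hz

variable [I.Boundaryless] [IsManifold I ∞ B] [J.Boundaryless] [IsManifold J ∞ F]

theorem chartSymmDeriv_prod (p : B × F) {z : E × E'}
    (hz : z ∈ (extChartAt (I.prod J) p).target) (u : E × E') :
    chartSymmDeriv (I.prod J) p z u =
      (chartSymmDeriv I p.1 z.1 u.1, chartSymmDeriv J p.2 z.2 u.2) := by
  have hz' := chart_target_prod p hz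
  have h1 : HasMFDerivAt 𝓘(ℝ, E × E') I ((extChartAt I p.1).symm ∘ Prod.fst) z
      ((mfderiv 𝓘(ℝ, E) I (extChartAt I p.1).symm z.1).comp (ContinuousLinearMap.fst ℝ E E')) :=
    HasMFDerivAt.comp z (mdifferentiableAt_chart_symm p.1 hz'.1).hasMFDerivAt
      (ContinuousLinearMap.fst ℝ E E').hasMFDerivAt
  have h2 : HasMFDerivAt 𝓘(ℝ, E × E') J ((extChartAt J p.2).symm ∘ Prod.snd) z
      ((mfderiv 𝓘(ℝ, E') J (extChartAt J p.2).symm z.2).comp (ContinuousLinearMap.snd ℝ E E')) :=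
    HasMFDerivAt.comp z (mdifferentiableAt_chart_symm p.2 hz'.2).hasMFDerivAt
      (ContinuousLinearMap.snd ℝ E E').hasMFDerivAt
  have h3 := h1.prodMk h2
  have h4 : ((extChartAt (I.prod J) p).symm : E × E' → B × F) =
      fun y => (((extChartAt I p.1).symm ∘ Prod.fst) y, ((extChartAt J p.2).symm ∘ Prod.snd) y) := by
    rw [extChartAt_prod]
    rfl
  have h5 : HasMFDerivAt 𝓘(ℝ, E × E') (I.prod J) (extChartAt (I.prod J) p).symm z
      (((mfderiv 𝓘(ℝ, E) I (extChartAt I p.1).symm z.1).comp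
          (ContinuousLinearMap.fst ℝ E E')).prod
        ((mfderiv 𝓘(ℝ, E') J (extChartAt J p.2).symm z.2).comp
          (ContinuousLinearMap.snd ℝ E E')) : E × E' →L[ℝ] E × E') := by
    rw [h4]
    exact h3
  exact DFunLike.congr_fun h5.mfderiv u

theorem chartRep_warped (gB : ∀ x : B, TangentSpace I x →L[ℝ] TangentSpace I x →L[ℝ] ℝ)
    (gF : ∀ q : F, TangentSpace J q →L[ℝ] TangentSpace J q →L[ℝ] ℝ) (f : B → ℝ) (p : B × F)
    {z : E × E'} (hz : z ∈ (extChartAt (I.prod J) p).target) (u v : E × E') :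
    chartRep (I.prod J) (warpedVal gB gF f) p z u v =
      chartRep I gB p.1 z.1 u.1 v.1 +
        (f ((extChartAt I p.1).symm z.1)) ^ 2 * chartRep J gF p.2 z.2 u.2 v.2 := by
  have hs : (extChartAt (I.prod J) p).symm z =
      ((extChartAt I p.1).symm z.1, (extChartAt J p.2).symm z.2) := by
    rw [extChartAt_prod]; rfl
  rw [chartRep_apply, chartSymmDeriv_prod p hz, chartSymmDeriv_prod p hz, hs]
  rfl

/-- The lift to the product of a tangent vector of the first factor: the tangent vector `X̃` at `p`
with `dτ X̃ = X` and `dσ X̃ = 0`; see `mfderiv_fst_liftFst` and `mfderiv_snd_liftFst`. -/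
def liftFst {p : B × F} (X : TangentSpace I p.1) : TangentSpace (I.prod J) p :=
  ContinuousLinearMap.inl ℝ E E' X

/-- The lift to the product of a tangent vector of the second factor: the tangent vector `Ũ` at `p`
with `dτ Ũ = 0` and `dσ Ũ = U`; see `mfderiv_fst_liftSnd` and `mfderiv_snd_liftSnd`. -/
def liftSnd {p : B × F} (U : TangentSpace J p.2) : TangentSpace (I.prod J) p :=
  ContinuousLinearMap.inr ℝ E E' U

theorem mfderiv_fst_liftFst {p : B × F} (X : TangentSpace I p.1) :
    mfderiv (I.prod J) I Prod.fst p (liftFst X) = X := by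
  rw [mfderiv_fst]; rfl

theorem mfderiv_snd_liftFst {p : B × F} (X : TangentSpace I p.1) :
    mfderiv (I.prod J) J Prod.snd p (liftFst X) = 0 := by
  rw [mfderiv_snd]; rfl

theorem mfderiv_fst_liftSnd {p : B × F} (U : TangentSpace J p.2) :
    mfderiv (I.prod J) I Prod.fst p (liftSnd U) = 0 := by
  rw [mfderiv_fst]; rfl

theorem mfderiv_snd_liftSnd {p : B × F} (U : TangentSpace J p.2) :
    mfderiv (I.prod J) J Prod.snd p (liftSnd U) = U := by
  rw [mfderiv_snd]; rfl

namespace Metric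

variable [FiniteDimensional ℝ E] [FiniteDimensional ℝ E']

/-- The warped product `B ×_f F`: the manifold `B × F` with the metric `τ^* g_B + f² σ^* g_F`, for a
smooth positive function `f` on `B`. -/
def warpedProduct (gB : Metric I B) (gF : Metric J F) (f : B → ℝ)
    (hf : ContMDiff I 𝓘(ℝ, ℝ) ∞ f) (hpos : ∀ x, 0 < f x) : Metric (I.prod J) (B × F) where
  val := warpedVal gB.val gF.val f
  symm p v w :=
    congrArg₂ (fun a b : ℝ => a + (f p.1) ^ 2 * b) (gB.symm p.1 v.1 w.1) (gF.symm p.2 v.2 w.2)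
  nondegenerate p v hv := by
    have h1 : v.1 = 0 := gB.nondegenerate p.1 v.1 fun w => by
      have h : gB.val p.1 v.1 w + (f p.1) ^ 2 * gF.val p.2 v.2 0 = 0 := hv (w, 0)
      rwa [map_zero, mul_zero, add_zero] at h
    have h2 : v.2 = 0 := gF.nondegenerate p.2 v.2 fun w => by
      have h : gB.val p.1 v.1 0 + (f p.1) ^ 2 * gF.val p.2 v.2 w = 0 := hv (0, w)
      rw [map_zero, zero_add] at h
      exact (mul_eq_zero.1 h).resolve_left (pow_ne_zero 2 (hpos p.1).ne')
    exact Prod.ext h1 h2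
  smooth p := by
    have hsub : ∀ z ∈ (extChartAt (I.prod J) p).target,
        z.1 ∈ (extChartAt I p.1).target ∧ z.2 ∈ (extChartAt J p.2).target :=
      fun z hz => chart_target_prod p hz
    have hfst : ContDiffOn ℝ ∞ (Prod.fst : E × E' → E) (extChartAt (I.prod J) p).target :=
      contDiff_fst.contDiffOn
    have hsnd : ContDiffOn ℝ ∞ (Prod.snd : E × E' → E') (extChartAt (I.prod J) p).target :=
      contDiff_snd.contDiffOn
    have hf' : ContDiffOn ℝ ∞ (f ∘ (extChartAt I p.1).symm) (extChartAt I p.1).target :=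
      contMDiffOn_iff_contDiffOn.1
        (hf.comp_contMDiffOn (contMDiffOn_extChartAt_symm p.1))
    refine contDiffOn_clm_apply.2 fun u => contDiffOn_clm_apply.2 fun v => ?_
    refine ContDiffOn.congr (f := fun z : E × E' => chartRep I gB.val p.1 z.1 u.1 v.1 +
        (f ((extChartAt I p.1).symm z.1)) ^ 2 * chartRep J gF.val p.2 z.2 u.2 v.2) ?_
      fun z hz => chartRep_warped gB.val gF.val f p hz u v
    have hB := (gB.smooth p.1).comp hfst fun z hz => (hsub z hz).1
    have hF := (gF.smooth p.2).comp hsnd fun z hz => (hsub z hz).2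
    have hf2 := hf'.comp hfst fun z hz => (hsub z hz).1
    exact ((hB.clm_apply contDiffOn_const).clm_apply contDiffOn_const).add
      ((hf2.pow 2).mul ((hF.clm_apply contDiffOn_const).clm_apply contDiffOn_const))

/-- The semi-Riemannian product metric `g_1 + g_2` on `B × F`: the warped product with warping
function `1`. -/
def prod (g₁ : Metric I B) (g₂ : Metric J F) : Metric (I.prod J) (B × F) :=
  g₁.warpedProduct g₂ (fun _ => 1) contMDiff_const fun _ => one_pos

theorem warpedProduct_apply (gB : Metric I B) (gF : Metric J F) (f : B → ℝ)
    (hf : ContMDiff I 𝓘(ℝ, ℝ) ∞ f) (hpos : ∀ x, 0 < f x) (p : B × F)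
    (v w : E × E') :
    (gB.warpedProduct gF f hf hpos).val p v w =
      gB.val p.1 v.1 w.1 + (f p.1) ^ 2 * gF.val p.2 v.2 w.2 := rfl

theorem prod_apply (g₁ : Metric I B) (g₂ : Metric J F) (p : B × F)
    (v w : E × E') :
    (g₁.prod g₂).val p v w = g₁.val p.1 v.1 w.1 + g₂.val p.2 v.2 w.2 := by
  rw [prod, warpedProduct_apply, one_pow, one_mul]

end Metric

end Warped

end SemiRiem

end

/-!
The proposition is an instance of one formula: for a warped product `B ×_φ F` and arbitrary vectors
`v + b`, `w + c` with `v, w` tangent to `B` and `b, c` tangent to `F`,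

`Ric (v + b, w + c) = Ric_B (v, w) - (d / φ) Hess φ (v, w) + Ric_F (b, c)
  - g_F (b, c) (φ Δφ + (d - 1) |∇φ|²)`

(`Metric.ricci_warpedProduct`). It is used for `M = B ×_f F` and, with `φ = 1`, for `B = B₁ × B₂`,
where it says that the Ricci tensor splits. The Hessian, the Laplacian and the gradient of
`f₁ + f₂` on `B₁ × B₂` split as well (`Metric.hess_prod`, `Metric.laplacian_prod`,
`Metric.normSqGrad_prod`), and `Hess₂ f₂ = 0` removes the terms in `f₂` from `Hess f` and `Δf`.
Putting zeros into the general formula yields every case of the claim, the mixed terms included.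

The general formula is proved in the preferred chart, where the metric has the form
`G = GB + φ² GF`. The Koszul formula and nondegeneracy of `G` determine its Christoffel symbols,

`Γ (v + b, w + c) = Γ_B (v, w) - φ GF (b, c) ∇φ
  + Γ_F (b, c) + (dφ (v) / φ) c + (dφ (w) / φ) b`

(`IsWarpedAt.christoffel_eq`). The trace defining the Ricci tensor only involves the diagonal blocks
of `u ↦ R(u, v) w`. The base block is `R_B(·, v) w - φ GF(b, c) ∇∇φ`
(`IsWarpedAt.fst_curvature_inl`), with `∇∇φ` the Hessian with an index raised
(`IsMetricAt.sharp_localHess`); the fibre block is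
`a ↦ R_F(a, b) c - (Hess φ (v, w) / φ) a - |∇φ|² (GF(b, c) a - GF(a, c) b)`
(`IsWarpedAt.snd_curvature_inr`).
-/

namespace SemiRiem

open scoped Topology

/-! ### Metrics in an open subset of a vector space -/

section LocalMetric

variable {E : Type*} [NormedAddCommGroup E] [NormedSpace ℝ E]

/-- Near `z`, the field of bilinear forms `G` is a semi-Riemannian metric of class `C²`. Two
derivatives suffice for the curvature, and finite regularity at a point propagates to a
neighbourhood. -/
structure IsMetricAt (G : E → (E →L[ℝ] E →L[ℝ] ℝ)) (z : E) : Prop where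
  contDiffAt : ContDiffAt ℝ 2 G z
  symm : ∀ᶠ y in 𝓝 z, ∀ v w, G y v w = G y w v
  nondegenerate : ∀ᶠ y in 𝓝 z, ∀ v, (∀ w, G y v w = 0) → v = 0

/-- The gradient of `φ` with respect to the metric `G`. -/
noncomputable def localGrad (G : E → (E →L[ℝ] E →L[ℝ] ℝ)) (φ : E → ℝ) (z : E) : E :=
  sharp (G z) (fderiv ℝ φ z)

theorem hasFDerivAt_clm_apply₂ {X V W K : Type*} [NormedAddCommGroup X] [NormedSpace ℝ X]
    [NormedAddCommGroup V] [NormedSpace ℝ V] [NormedAddCommGroup W] [NormedSpace ℝ W]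
    [NormedAddCommGroup K] [NormedSpace ℝ K] {T : X → V →L[ℝ] W →L[ℝ] K} {z : X}
    (hT : DifferentiableAt ℝ T z) (v : V) (w : W) :
    HasFDerivAt (fun y => T y v w) (((fderiv ℝ T z).flip v).flip w) z := by
  have h := (hT.hasFDerivAt.clm_apply (hasFDerivAt_const v z)).clm_apply (hasFDerivAt_const w z)
  refine h.congr_fderiv ?_
  ext t
  simp

theorem fderiv_clm_apply₂ {X V W K : Type*} [NormedAddCommGroup X] [NormedSpace ℝ X]
    [NormedAddCommGroup V] [NormedSpace ℝ V] [NormedAddCommGroup W] [NormedSpace ℝ W]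
    [NormedAddCommGroup K] [NormedSpace ℝ K] {T : X → V →L[ℝ] W →L[ℝ] K} {z : X}
    (hT : DifferentiableAt ℝ T z) (t : X) (v : V) (w : W) :
    fderiv ℝ T z t v w = fderiv ℝ (fun y => T y v w) z t := by
  rw [(hasFDerivAt_clm_apply₂ hT v w).fderiv]
  rfl

variable {G : E → (E →L[ℝ] E →L[ℝ] ℝ)} {φ : E → ℝ} {z : E}

namespace IsMetricAt

theorem eventually (h : IsMetricAt G z) : ∀ᶠ y in 𝓝 z, IsMetricAt G y := by
  filter_upwards [h.contDiffAt.eventually (by simp), h.symm.eventually_nhds,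
    h.nondegenerate.eventually_nhds] with y h1 h2 h3
  exact ⟨h1, h2, h3⟩

theorem differentiableAt (h : IsMetricAt G z) : DifferentiableAt ℝ G z :=
  h.contDiffAt.differentiableAt (by simp)

theorem symm_self (h : IsMetricAt G z) (v w : E) : G z v w = G z w v :=
  h.symm.self_of_nhds v w

theorem fderiv_symm (h : IsMetricAt G z) (t v w : E) :
    fderiv ℝ G z t v w = fderiv ℝ G z t w v := by
  rw [fderiv_clm_apply₂ h.differentiableAt, fderiv_clm_apply₂ h.differentiableAt]
  congr 1
  exact Filter.EventuallyEq.fderiv_eq (h.symm.mono fun y hy => hy v w)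

theorem ext (h : IsMetricAt G z) {u v : E} (huv : ∀ w, G z u w = G z v w) : u = v :=
  sub_eq_zero.1 <| h.nondegenerate.self_of_nhds _ fun w => by simp [huv w]

theorem christoffelFirst_symm (h : IsMetricAt G z) (u v : E) :
    christoffelFirst G z u v = christoffelFirst G z v u := by
  ext w
  rw [christoffelFirst_apply, christoffelFirst_apply, h.fderiv_symm w u v]
  ring

theorem christoffel_symm (h : IsMetricAt G z) (u v : E) :
    christoffel G z u v = christoffel G z v u := by
  rw [christoffel_apply, christoffel_apply, h.christoffelFirst_symm]

variable [FiniteDimensional ℝ E]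

theorem isInvertible (h : IsMetricAt G z) : (G z).IsInvertible := by
  let L : E →ₗ[ℝ] (E →L[ℝ] ℝ) := (G z).toLinearMap
  have hinj : Function.Injective L := fun u v huv => h.ext fun w => DFunLike.congr_fun huv w
  have hdim : Module.finrank ℝ E = Module.finrank ℝ (E →L[ℝ] ℝ) := by
    rw [← (LinearMap.toContinuousLinearMap (𝕜 := ℝ) (E := E) (F' := ℝ)).finrank_eq]
    exact (Subspace.dual_finrank_eq (K := ℝ) (V := E)).symm
  let e := (LinearEquiv.ofInjectiveOfFinrankEq L hinj hdim).toContinuousLinearEquiv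
  exact ⟨e, by ext u v; rfl⟩

theorem apply_sharp (h : IsMetricAt G z) (α : E →L[ℝ] ℝ) (w : E) : G z (sharp (G z) α) w = α w := by
  rw [sharp, h.isInvertible.self_apply_inverse]

theorem apply_localGrad (h : IsMetricAt G z) (φ : E → ℝ) (w : E) :
    G z (localGrad G φ z) w = fderiv ℝ φ z w := h.apply_sharp _ w

theorem apply_christoffel (h : IsMetricAt G z) (u v w : E) :
    G z (christoffel G z u v) w = 2⁻¹ * (fderiv ℝ G z u v w + fderiv ℝ G z v u w -
      fderiv ℝ G z w u v) := by
  rw [christoffel_apply, map_smul, smul_apply, h.apply_sharp,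
    christoffelFirst_apply, smul_eq_mul]

theorem contDiffAt_sharp (h : IsMetricAt G z) : ContDiffAt ℝ 2 (fun y => sharp (G y)) z :=
  h.isInvertible.contDiffAt_map_inverse.comp z h.contDiffAt

theorem differentiableAt_localGrad (h : IsMetricAt G z) (hφ : ContDiffAt ℝ 2 φ z) :
    DifferentiableAt ℝ (localGrad G φ) z :=
  (h.contDiffAt_sharp.differentiableAt (by simp)).clm_apply
    ((hφ.fderiv_right (m := 1) (by norm_num)).differentiableAt (by simp))

theorem differentiableAt_christoffel (h : IsMetricAt G z) :
    DifferentiableAt ℝ (christoffel G) z := by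
  have h1 : DifferentiableAt ℝ (fderiv ℝ G) z :=
    (h.contDiffAt.fderiv_right (m := 1) (by norm_num)).differentiableAt (by simp)
  have h2 : DifferentiableAt ℝ (fun y => sharp (G y)) z :=
    h.contDiffAt_sharp.differentiableAt (by simp)
  have h3 : DifferentiableAt ℝ (fun y => (fderiv ℝ G y).flip) z :=
    (ContinuousLinearMap.flipₗᵢ ℝ E E (E →L[ℝ] ℝ)).differentiableAt.comp z h1
  have h4 : DifferentiableAt ℝ (christoffelFirst G) z :=
    (h1.add h3).sub ((differentiableAt_const _).clm_comp h3)
  have h5 : DifferentiableAt ℝ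
      (fun y => ContinuousLinearMap.compL ℝ E (E →L[ℝ] ℝ) E (sharp (G y))) z :=
    (ContinuousLinearMap.compL ℝ E (E →L[ℝ] ℝ) E).differentiableAt.comp z h2
  exact (h5.const_smul (2⁻¹ : ℝ)).clm_comp h4

/-- The Hessian is the covariant derivative of the gradient:
`∇_u ∇φ = ∂_u ∇φ + Γ(u, ∇φ) = (Hess φ (u, ·))^♯`. -/
theorem sharp_localHess (h : IsMetricAt G z) (hφ : ContDiffAt ℝ 2 φ z) (u : E) :
    sharp (G z) (localHess G φ z u) =
      fderiv ℝ (localGrad G φ) z u + christoffel G z u (localGrad G φ z) := by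
  refine h.ext fun w => ?_
  have hg := h.differentiableAt_localGrad hφ
  have hdφ : DifferentiableAt ℝ (fderiv ℝ φ) z :=
    (hφ.fderiv_right (m := 1) (by norm_num)).differentiableAt (by simp)
  -- differentiate `G (∇φ, w) = dφ w`
  have key : fderiv ℝ G z u (localGrad G φ z) w + G z (fderiv ℝ (localGrad G φ) z u) w =
      fderiv ℝ (fderiv ℝ φ) z u w := by
    have h1 := (h.differentiableAt.hasFDerivAt.clm_apply hg.hasFDerivAt).clm_apply
      (hasFDerivAt_const w z)
    have h2 := hdφ.hasFDerivAt.clm_apply (hasFDerivAt_const w z)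
    have h3 : (fun y => G y (localGrad G φ y) w) =ᶠ[𝓝 z] fun y => fderiv ℝ φ y w :=
      h.eventually.mono fun y hy => hy.apply_localGrad φ w
    have h4 := DFunLike.congr_fun ((h1.congr_of_eventuallyEq h3.symm).unique h2) u
    simp at h4
    linarith
  have hΓ : fderiv ℝ φ z (christoffel G z u w) = 2⁻¹ * (fderiv ℝ G z u w (localGrad G φ z) +
      fderiv ℝ G z w u (localGrad G φ z) - fderiv ℝ G z (localGrad G φ z) u w) := by
    rw [← h.apply_localGrad, h.symm_self, h.apply_christoffel]
  rw [h.apply_sharp, localHess_apply, hΓ, map_add, add_apply,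
    h.apply_christoffel, ← key, h.fderiv_symm u w, h.fderiv_symm w u]
  ring

end IsMetricAt

end LocalMetric

/-! ### The Levi-Civita connection and the curvature of a warped product -/

section LocalWarped

variable {E : Type*} [NormedAddCommGroup E] [NormedSpace ℝ E]
  {E' : Type*} [NormedAddCommGroup E'] [NormedSpace ℝ E']

/-- Near `z`, the metric `G` on the product is the warped product `GB + φ² GF` of the metrics `GB`
and `GF` with the warping function `φ`. -/
structure IsWarpedAt (GB : E → (E →L[ℝ] E →L[ℝ] ℝ)) (GF : E' → (E' →L[ℝ] E' →L[ℝ] ℝ))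
    (φ : E → ℝ) (G : E × E' → (E × E' →L[ℝ] E × E' →L[ℝ] ℝ)) (z : E × E') : Prop where
  base : IsMetricAt GB z.1
  fibre : IsMetricAt GF z.2
  total : IsMetricAt G z
  warping : ContDiffAt ℝ 2 φ z.1
  ne_zero : φ z.1 ≠ 0
  apply_eq : ∀ᶠ y in 𝓝 z, ∀ v w,
    G y v w = GB y.1 v.1 w.1 + φ y.1 ^ 2 * GF y.2 v.2 w.2

namespace IsWarpedAt

variable {GB : E → (E →L[ℝ] E →L[ℝ] ℝ)} {GF : E' → (E' →L[ℝ] E' →L[ℝ] ℝ)} {φ : E → ℝ}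
  {G : E × E' → (E × E' →L[ℝ] E × E' →L[ℝ] ℝ)} {z : E × E'}

theorem eventually (h : IsWarpedAt GB GF φ G z) : ∀ᶠ y in 𝓝 z, IsWarpedAt GB GF φ G y := by
  filter_upwards [continuousAt_fst.eventually h.base.eventually,
    continuousAt_snd.eventually h.fibre.eventually, h.total.eventually,
    continuousAt_fst.eventually (h.warping.eventually (by simp)),
    continuousAt_fst.eventually (h.warping.continuousAt.eventually_ne h.ne_zero),
    h.apply_eq.eventually_nhds] with y h1 h2 h3 h4 h5 h6
  exact ⟨h1, h2, h3, h4, h5, h6⟩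

theorem fderiv_apply (h : IsWarpedAt GB GF φ G z) (t v w : E × E') :
    fderiv ℝ G z t v w = fderiv ℝ GB z.1 t.1 v.1 w.1 +
      2 * φ z.1 * fderiv ℝ φ z.1 t.1 * GF z.2 v.2 w.2 +
      φ z.1 ^ 2 * fderiv ℝ GF z.2 t.2 v.2 w.2 := by
  have hB := (hasFDerivAt_clm_apply₂ h.base.differentiableAt v.1 w.1).comp z hasFDerivAt_fst
  have hF := (hasFDerivAt_clm_apply₂ h.fibre.differentiableAt v.2 w.2).comp z hasFDerivAt_snd
  have hφ := (h.warping.differentiableAt (by simp)).hasFDerivAt.comp z hasFDerivAt_fst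
  have hsum := hB.add ((hφ.pow 2).mul hF)
  rw [fderiv_clm_apply₂ h.total.differentiableAt, (hsum.congr_of_eventuallyEq
    (h.apply_eq.mono fun y hy => hy v w)).fderiv]
  simp
  ring

variable [FiniteDimensional ℝ E] [FiniteDimensional ℝ E']

/-- The Christoffel symbols of a warped product: both sides have the same `G`-products with every
vector, by the Koszul formula for `G`, `GB` and `GF`. -/
theorem christoffel_eq (h : IsWarpedAt GB GF φ G z) (v w : E × E') :
    christoffel G z v w =
      (christoffel GB z.1 v.1 w.1 - (φ z.1 * GF z.2 v.2 w.2) • localGrad GB φ z.1,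
        christoffel GF z.2 v.2 w.2 + (fderiv ℝ φ z.1 v.1 / φ z.1) • w.2 +
          (fderiv ℝ φ z.1 w.1 / φ z.1) • v.2) := by
  have hφ := h.ne_zero
  refine h.total.ext fun t => ?_
  rw [h.total.apply_christoffel, h.fderiv_apply, h.fderiv_apply, h.fderiv_apply,
    h.apply_eq.self_of_nhds]
  simp only [map_add, map_sub, map_smul, add_apply, sub_apply, smul_apply, smul_eq_mul,
    h.base.apply_christoffel, h.fibre.apply_christoffel, h.base.apply_localGrad]
  field_simp
  ring

theorem fst_fderiv_christoffel (h : IsWarpedAt GB GF φ G z) (t v w : E × E') :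
    (fderiv ℝ (christoffel G) z t v w).1 =
      fderiv ℝ (christoffel GB) z.1 t.1 v.1 w.1 -
        ((φ z.1 * GF z.2 v.2 w.2) • fderiv ℝ (localGrad GB φ) z.1 t.1 +
        (φ z.1 * fderiv ℝ GF z.2 t.2 v.2 w.2 + fderiv ℝ φ z.1 t.1 * GF z.2 v.2 w.2) •
          localGrad GB φ z.1) := by
  have hΓ := hasFDerivAt_clm_apply₂ h.total.differentiableAt_christoffel v w
  have hB := (hasFDerivAt_clm_apply₂ h.base.differentiableAt_christoffel v.1 w.1).comp z
    hasFDerivAt_fst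
  have hF := (hasFDerivAt_clm_apply₂ h.fibre.differentiableAt v.2 w.2).comp z hasFDerivAt_snd
  have hφ := (h.warping.differentiableAt (by simp)).hasFDerivAt.comp z hasFDerivAt_fst
  have hg := (h.base.differentiableAt_localGrad h.warping).hasFDerivAt.comp z hasFDerivAt_fst
  have h1 := hB.sub ((hφ.mul hF).smul hg)
  have h2 := DFunLike.congr_fun ((h1.congr_of_eventuallyEq (h.eventually.mono fun y hy =>
    congrArg Prod.fst (hy.christoffel_eq v w))).unique hΓ.fst) t
  simp at h2
  rw [← h2]
  module

theorem snd_fderiv_christoffel (h : IsWarpedAt GB GF φ G z) (t v w : E × E') :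
    (fderiv ℝ (christoffel G) z t v w).2 =
      fderiv ℝ (christoffel GF) z.2 t.2 v.2 w.2 +
        (fderiv ℝ (fderiv ℝ φ) z.1 t.1 v.1 / φ z.1 -
          fderiv ℝ φ z.1 t.1 * fderiv ℝ φ z.1 v.1 / φ z.1 ^ 2) • w.2 +
        (fderiv ℝ (fderiv ℝ φ) z.1 t.1 w.1 / φ z.1 -
          fderiv ℝ φ z.1 t.1 * fderiv ℝ φ z.1 w.1 / φ z.1 ^ 2) • v.2 := by
  have hΓ := hasFDerivAt_clm_apply₂ h.total.differentiableAt_christoffel v w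
  have hF := (hasFDerivAt_clm_apply₂ h.fibre.differentiableAt_christoffel v.2 w.2).comp z
    hasFDerivAt_snd
  have hφ := (h.warping.differentiableAt (by simp)).hasFDerivAt.comp z hasFDerivAt_fst
  have hdφ (u : E) := (((h.warping.fderiv_right (m := 1) (by norm_num)).differentiableAt
    (by simp)).hasFDerivAt.clm_apply (hasFDerivAt_const u z.1)).comp z hasFDerivAt_fst
  have hinv := (hasDerivAt_inv h.ne_zero).comp_hasFDerivAt z hφ
  have h1 := (hF.add (((hdφ v.1).mul hinv).smul_const w.2)).add
    (((hdφ w.1).mul hinv).smul_const v.2)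
  have h2 := DFunLike.congr_fun ((h1.congr_of_eventuallyEq (h.eventually.mono fun y hy =>
    congrArg Prod.snd (hy.christoffel_eq v w))).unique hΓ.snd) t
  simp at h2
  rw [← h2]
  have h0 := h.ne_zero
  match_scalars <;> field_simp <;> ring

/-- The base component of `u ↦ R(u, v) w` on vectors `u` tangent to the base. -/
theorem fst_curvature_inl (h : IsWarpedAt GB GF φ G z) (v w : E × E') (u : E) :
    (curvature G z v w (u, 0)).1 = curvature GB z.1 v.1 w.1 u -
      (φ z.1 * GF z.2 v.2 w.2) • sharp (GB z.1) (localHess GB φ z.1 u) := by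
  have h0 := h.ne_zero
  rw [curvature_apply, h.christoffel_eq v w, h.christoffel_eq (u, 0) w, h.christoffel_eq,
    h.christoffel_eq, curvature_apply, h.base.sharp_localHess h.warping]
  simp only [Prod.fst_add, Prod.fst_sub, h.fst_fderiv_christoffel, map_zero, map_add, map_sub,
    map_smul, zero_apply, smul_zero, add_zero, mul_zero, zero_add, smul_eq_mul]
  match_scalars <;> field_simp
  ring

/-- The fibre component of `u ↦ R(u, v) w` on vectors `u` tangent to the fibre. -/
theorem snd_curvature_inr (h : IsWarpedAt GB GF φ G z) (v w : E × E') (a : E') :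
    (curvature G z v w (0, a)).2 = curvature GF z.2 v.2 w.2 a -
      (localHess GB φ z.1 v.1 w.1 / φ z.1) • a -
      GB z.1 (localGrad GB φ z.1) (localGrad GB φ z.1) •
        (GF z.2 v.2 w.2 • a - GF z.2 a w.2 • v.2) := by
  have h0 := h.ne_zero
  rw [curvature_apply, h.christoffel_eq v w, h.christoffel_eq (0, a) w, h.christoffel_eq,
    h.christoffel_eq, curvature_apply, localHess_apply, h.base.apply_localGrad]
  simp only [Prod.snd_add, Prod.snd_sub, h.snd_fderiv_christoffel, map_zero, map_add, map_sub,
    map_smul, zero_apply, zero_smul, smul_zero, add_zero, mul_zero, smul_eq_mul,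
    zero_sub, map_neg, zero_mul, zero_div, sub_zero,
    h.fibre.christoffel_symm v.2 a]
  match_scalars <;> field_simp <;> ring

end IsWarpedAt

theorem trace_prod [FiniteDimensional ℝ E] [FiniteDimensional ℝ E']
    (L : E × E' →ₗ[ℝ] E × E') :
    LinearMap.trace ℝ (E × E') L =
      LinearMap.trace ℝ E (LinearMap.fst ℝ E E' ∘ₗ L ∘ₗ LinearMap.inl ℝ E E') +
      LinearMap.trace ℝ E' (LinearMap.snd ℝ E E' ∘ₗ L ∘ₗ LinearMap.inr ℝ E E') := by
  rw [LinearMap.trace_comp_comm' _ (LinearMap.fst ℝ E E'),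
    LinearMap.trace_comp_comm' _ (LinearMap.snd ℝ E E'), ← map_add]
  congr 1
  ext u <;> simp [Prod.mk_zero_zero]

variable {GB : E → (E →L[ℝ] E →L[ℝ] ℝ)} {GF : E' → (E' →L[ℝ] E' →L[ℝ] ℝ)} {φ : E → ℝ}
  {G : E × E' → (E × E' →L[ℝ] E × E' →L[ℝ] ℝ)} {z : E × E'}

/-- The Ricci tensor of a warped product, for arbitrary pairs of vectors. The two coefficients of
`|∇φ|²` are the traces of `a ↦ GF(b, c) a` and of the rank one map `a ↦ GF(a, c) b`. -/
theorem IsWarpedAt.localRicci_eq [FiniteDimensional ℝ E] [FiniteDimensional ℝ E']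
    (h : IsWarpedAt GB GF φ G z) (v w : E × E') :
    localRicci G z v w = localRicci GB z.1 v.1 w.1 -
        Module.finrank ℝ E' / φ z.1 * localHess GB φ z.1 v.1 w.1 + localRicci GF z.2 v.2 w.2 -
      GF z.2 v.2 w.2 * (φ z.1 *
          LinearMap.trace ℝ E (sharp (GB z.1) ∘L localHess GB φ z.1).toLinearMap +
        (Module.finrank ℝ E' - 1) * GB z.1 (localGrad GB φ z.1) (localGrad GB φ z.1)) := by
  have h1 : LinearMap.fst ℝ E E' ∘ₗ (curvature G z v w).toLinearMap ∘ₗ LinearMap.inl ℝ E E' =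
      (curvature GB z.1 v.1 w.1).toLinearMap - (φ z.1 * GF z.2 v.2 w.2) •
        (sharp (GB z.1) ∘L localHess GB φ z.1).toLinearMap :=
    LinearMap.ext fun u => h.fst_curvature_inl v w u
  have h2 : LinearMap.snd ℝ E E' ∘ₗ (curvature G z v w).toLinearMap ∘ₗ LinearMap.inr ℝ E E' =
      (curvature GF z.2 v.2 w.2).toLinearMap -
        (localHess GB φ z.1 v.1 w.1 / φ z.1) • LinearMap.id -
        GB z.1 (localGrad GB φ z.1) (localGrad GB φ z.1) • (GF z.2 v.2 w.2 • LinearMap.id -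
          ((GF z.2).flip w.2).toLinearMap.smulRight v.2) :=
    LinearMap.ext fun a => h.snd_curvature_inr v w a
  rw [localRicci, trace_prod, h1, h2]
  simp only [map_sub, map_smul, LinearMap.trace_id, LinearMap.trace_smulRight, smul_eq_mul,
    localRicci, ContinuousLinearMap.coe_coe, ContinuousLinearMap.flip_apply]
  ring

end LocalWarped

/-! ### Products of metrics in coordinates -/

section LocalProduct

variable {E : Type*} [NormedAddCommGroup E] [NormedSpace ℝ E]
  {E' : Type*} [NormedAddCommGroup E'] [NormedSpace ℝ E']
  {G₁ : E → (E →L[ℝ] E →L[ℝ] ℝ)} {G₂ : E' → (E' →L[ℝ] E' →L[ℝ] ℝ)}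
  {G : E × E' → (E × E' →L[ℝ] E × E' →L[ℝ] ℝ)} {φ₁ : E → ℝ} {φ₂ : E' → ℝ} {z : E × E'}

theorem localGrad_const (G : E → (E →L[ℝ] E →L[ℝ] ℝ)) (c : ℝ) (z : E) :
    localGrad G (fun _ => c) z = 0 := by
  simp [localGrad]

theorem localHess_const (G : E → (E →L[ℝ] E →L[ℝ] ℝ)) (c : ℝ) (z : E) :
    localHess G (fun _ => c) z = 0 := by
  have h : fderiv ℝ (fun _ : E => c) = 0 := funext fun z => fderiv_const_apply c
  simp [localHess, h]

theorem localRicci_zero_left (G : E → (E →L[ℝ] E →L[ℝ] ℝ)) (z w : E) : localRicci G z 0 w = 0 := by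
  have h : curvature G z 0 w = 0 := by
    ext u
    simp [curvature_apply]
  rw [localRicci, h]
  exact map_zero _

theorem localRicci_zero_right (G : E → (E →L[ℝ] E →L[ℝ] ℝ)) (z v : E) : localRicci G z v 0 = 0 := by
  have h : curvature G z v 0 = 0 := by
    ext u
    simp [curvature_apply]
  rw [localRicci, h]
  exact map_zero _

/-- For a product metric, the Hessian of a sum of functions of the two factors splits. -/
theorem IsWarpedAt.localHess_add [FiniteDimensional ℝ E] [FiniteDimensional ℝ E']
    (h : IsWarpedAt G₁ G₂ (fun _ => 1) G z)
    (h₁ : ContDiffAt ℝ 2 φ₁ z.1) (h₂ : ContDiffAt ℝ 2 φ₂ z.2) (v w : E × E') :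
    localHess G (fun y => φ₁ y.1 + φ₂ y.2) z v w =
      localHess G₁ φ₁ z.1 v.1 w.1 + localHess G₂ φ₂ z.2 v.2 w.2 := by
  have hd {y : E × E'} (h₁ : ContDiffAt ℝ 2 φ₁ y.1) (h₂ : ContDiffAt ℝ 2 φ₂ y.2) :
      HasFDerivAt (fun y : E × E' => φ₁ y.1 + φ₂ y.2)
        (fderiv ℝ φ₁ y.1 ∘L ContinuousLinearMap.fst ℝ E E' +
          fderiv ℝ φ₂ y.2 ∘L ContinuousLinearMap.snd ℝ E E') y :=
    ((h₁.differentiableAt (by simp)).hasFDerivAt.comp y hasFDerivAt_fst).add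
      ((h₂.differentiableAt (by simp)).hasFDerivAt.comp y hasFDerivAt_snd)
  have hev : fderiv ℝ (fun y : E × E' => φ₁ y.1 + φ₂ y.2) =ᶠ[𝓝 z] fun y =>
      fderiv ℝ φ₁ y.1 ∘L ContinuousLinearMap.fst ℝ E E' +
        fderiv ℝ φ₂ y.2 ∘L ContinuousLinearMap.snd ℝ E E' := by
    filter_upwards [continuousAt_fst.eventually (h₁.eventually (by simp)),
      continuousAt_snd.eventually (h₂.eventually (by simp))] with y hy₁ hy₂
    exact (hd hy₁ hy₂).fderiv
  have hd₁ := (((h₁.fderiv_right (m := 1) (by norm_num)).differentiableAt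
    (by simp)).hasFDerivAt.comp z hasFDerivAt_fst).clm_comp
      (hasFDerivAt_const (ContinuousLinearMap.fst ℝ E E') z)
  have hd₂ := (((h₂.fderiv_right (m := 1) (by norm_num)).differentiableAt
    (by simp)).hasFDerivAt.comp z hasFDerivAt_snd).clm_comp
      (hasFDerivAt_const (ContinuousLinearMap.snd ℝ E E') z)
  rw [localHess_apply, localHess_apply, localHess_apply, (hd h₁ h₂).fderiv, h.christoffel_eq,
    ((hd₁.add hd₂).congr_of_eventuallyEq hev).fderiv]
  simp [localGrad_const]
  ring

end LocalProduct

/-! ### Metrics on manifolds in the preferred charts -/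

section Chart

variable {E : Type*} [NormedAddCommGroup E] [NormedSpace ℝ E]
  {H : Type*} [TopologicalSpace H] {I : ModelWithCorners ℝ E H} [I.Boundaryless]
  {M : Type*} [TopologicalSpace M] [ChartedSpace H M] [IsManifold I ∞ M]

theorem chartSymmDeriv_isInvertible (p : M) {z : E} (hz : z ∈ (extChartAt I p).target) :
    (chartSymmDeriv I p z).IsInvertible := by
  have : IsManifold I 1 M := IsManifold.of_le (n := ∞) (by simp)
  have h := isInvertible_mfderivWithin_extChartAt_symm hz
  rwa [I.range_eq_univ, mfderivWithin_univ] at h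

theorem chartSymmDeriv_self (p : M) (u : E) :
    chartSymmDeriv I p (extChartAt I p p) u = u := by
  have : IsManifold I 1 M := IsManifold.of_le (n := ∞) (by simp)
  have h := mfderivWithin_range_extChartAt_symm (I := I) (x := p)
  rw [I.range_eq_univ, mfderivWithin_univ] at h
  exact DFunLike.congr_fun h u

/-- The preferred chart around `p` identifies the tangent space at `p` with the model space, so
there the components of a bilinear form are the form itself. -/
theorem chartRep_self (g : ∀ x : M, TangentSpace I x →L[ℝ] TangentSpace I x →L[ℝ] ℝ) (p : M) :
    chartRep I g p (extChartAt I p p) = (g p : E →L[ℝ] E →L[ℝ] ℝ) := by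
  have h (q : M) (hq : q = p) : (g q : E →L[ℝ] E →L[ℝ] ℝ) = g p := by
    subst hq
    rfl
  ext u v
  rw [chartRep_apply, chartSymmDeriv_self, chartSymmDeriv_self]
  exact congrArg (fun b : E →L[ℝ] E →L[ℝ] ℝ => b u v) (h _ (extChartAt_to_inv p))

namespace Metric

theorem isMetricAt (g : Metric I M) (p : M) {z : E} (hz : z ∈ (extChartAt I p).target) :
    IsMetricAt (chartRep I g.val p) z where
  contDiffAt := ((g.smooth p).contDiffAt
    ((isOpen_extChartAt_target p).mem_nhds hz)).of_le (by norm_cast)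
  symm := .of_forall fun y v w =>
    g.symm _ (chartSymmDeriv I p y v) (chartSymmDeriv I p y w)
  nondegenerate := by
    filter_upwards [(isOpen_extChartAt_target p).mem_nhds hz] with y hy v hv
    have hinv := chartSymmDeriv_isInvertible p hy
    have h0 : chartSymmDeriv I p y v = 0 := g.nondegenerate _ _ fun w => by
      obtain ⟨w', rfl⟩ := hinv.surjective w
      exact hv w'
    exact hinv.injective (h0.trans (map_zero (chartSymmDeriv I p y)).symm)

theorem isMetricAt_self (g : Metric I M) (p : M) :
    IsMetricAt (chartRep I g.val p) (extChartAt I p p) :=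
  g.isMetricAt p (mem_extChartAt_target p)

theorem contDiffAt_comp_symm {f : M → ℝ} (hf : ContMDiff I 𝓘(ℝ, ℝ) ∞ f) (p : M) :
    ContDiffAt ℝ 2 (f ∘ (extChartAt I p).symm) (extChartAt I p p) := by
  have h : ContDiffOn ℝ ∞ (f ∘ (extChartAt I p).symm) (extChartAt I p).target :=
    contMDiffOn_iff_contDiffOn.1 (hf.comp_contMDiffOn (contMDiffOn_extChartAt_symm p))
  exact (h.contDiffAt (extChartAt_target_mem_nhds p)).of_le (by norm_cast)

theorem mfderiv_eq_fderiv_chart {f : M → ℝ} (hf : ContMDiff I 𝓘(ℝ, ℝ) ∞ f) (p : M) :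
    mfderiv I 𝓘(ℝ, ℝ) f p = fderiv ℝ (f ∘ (extChartAt I p).symm) (extChartAt I p p) := by
  refine (hf.mdifferentiable (by simp) p).mfderiv.trans ?_
  rw [I.range_eq_univ]
  exact congrFun (fderivWithin_univ (f := f ∘ (extChartAt I p).symm)) _

theorem sharpAt_eq (g : Metric I M) (p : M) :
    g.sharpAt p = sharp (chartRep I g.val p (extChartAt I p p)) := by
  rw [chartRep_self]
  rfl

theorem laplacian_eq_trace (g : Metric I M) (f : M → ℝ) (p : M) :
    g.laplacian f p = LinearMap.trace ℝ E (sharp (chartRep I g.val p (extChartAt I p p)) ∘L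
      localHess (chartRep I g.val p) (f ∘ (extChartAt I p).symm)
        (extChartAt I p p)).toLinearMap := by
  rw [← sharpAt_eq]
  rfl

theorem grad_eq_localGrad (g : Metric I M) {f : M → ℝ} (hf : ContMDiff I 𝓘(ℝ, ℝ) ∞ f) (p : M) :
    g.grad f p =
      localGrad (chartRep I g.val p) (f ∘ (extChartAt I p).symm) (extChartAt I p p) := by
  rw [grad, mfderiv_eq_fderiv_chart hf, sharpAt_eq]
  rfl

theorem normSqGrad_eq (g : Metric I M) {f : M → ℝ} (hf : ContMDiff I 𝓘(ℝ, ℝ) ∞ f) (p : M) :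
    g.normSqGrad f p = chartRep I g.val p (extChartAt I p p)
      (localGrad (chartRep I g.val p) (f ∘ (extChartAt I p).symm) (extChartAt I p p))
      (localGrad (chartRep I g.val p) (f ∘ (extChartAt I p).symm) (extChartAt I p p)) := by
  rw [← grad_eq_localGrad g hf, chartRep_self]
  rfl

theorem val_sharpAt [FiniteDimensional ℝ E] (g : Metric I M) (p : M)
    (α : TangentSpace I p →L[ℝ] ℝ) (w : TangentSpace I p) : g.val p (g.sharpAt p α) w = α w := by
  have h := (g.isMetricAt_self p).apply_sharp α w
  rw [chartRep_self] at h
  exact h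

theorem hess_const (g : Metric I M) (c : ℝ) (p : M) : g.hess (fun _ => c) p = 0 :=
  localHess_const (chartRep I g.val p) c (extChartAt I p p)

theorem ext_val (g : Metric I M) (p : M) {u v : TangentSpace I p}
    (h : ∀ w, g.val p u w = g.val p v w) : u = v := by
  refine (g.isMetricAt_self p).ext fun w => ?_
  rw [chartRep_self]
  exact h w

theorem ricci_zero_left (g : Metric I M) (p : M) (w : E) : g.ricci p (0 : E) w = 0 :=
  localRicci_zero_left _ _ w

theorem ricci_zero_right (g : Metric I M) (p : M) (v : E) : g.ricci p v (0 : E) = 0 :=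
  localRicci_zero_right _ _ v

theorem laplacian_eq_zero_of_hess_eq_zero (g : Metric I M) {f : M → ℝ} {p : M}
    (h : g.hess f p = 0) : g.laplacian f p = 0 := by
  rw [laplacian, h, ContinuousLinearMap.comp_zero]
  exact map_zero _

theorem grad_const (g : Metric I M) (c : ℝ) (p : M) : g.grad (fun _ => c) p = 0 := by
  exact (congrArg (g.sharpAt p) mfderiv_const).trans (map_zero (g.sharpAt p))

theorem normSqGrad_const (g : Metric I M) (c : ℝ) (p : M) :
    g.normSqGrad (fun _ => c) p = 0 := by
  rw [normSqGrad, grad_const, map_zero]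

end Metric

end Chart

/-! ### Warped products and products of manifolds -/

section Product

variable {E : Type*} [NormedAddCommGroup E] [NormedSpace ℝ E] [FiniteDimensional ℝ E]
  {H : Type*} [TopologicalSpace H] {I : ModelWithCorners ℝ E H} [I.Boundaryless]
  {B : Type*} [TopologicalSpace B] [ChartedSpace H B] [IsManifold I ∞ B]
  {E' : Type*} [NormedAddCommGroup E'] [NormedSpace ℝ E'] [FiniteDimensional ℝ E']
  {H' : Type*} [TopologicalSpace H'] {J : ModelWithCorners ℝ E' H'} [J.Boundaryless]
  {F : Type*} [TopologicalSpace F] [ChartedSpace H' F] [IsManifold J ∞ F]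

namespace Metric

theorem isWarpedAt_warpedProduct (gB : Metric I B) (gF : Metric J F) (f : B → ℝ)
    (hf : ContMDiff I 𝓘(ℝ, ℝ) ∞ f) (hpos : ∀ x, 0 < f x) (p : B × F) :
    IsWarpedAt (chartRep I gB.val p.1) (chartRep J gF.val p.2) (f ∘ (extChartAt I p.1).symm)
      (chartRep (I.prod J) (gB.warpedProduct gF f hf hpos).val p)
      (extChartAt I p.1 p.1, extChartAt J p.2 p.2) where
  base := gB.isMetricAt_self p.1
  fibre := gF.isMetricAt_self p.2
  total := (gB.warpedProduct gF f hf hpos).isMetricAt_self p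
  warping := contDiffAt_comp_symm hf p.1
  ne_zero := (hpos _).ne'
  apply_eq := by
    filter_upwards [extChartAt_target_mem_nhds (I := I.prod J) p] with y hy v w
    exact chartRep_warped gB.val gF.val f p hy v w

/-- The Ricci tensor of a warped product, for arbitrary pairs of vectors. -/
theorem ricci_warpedProduct (gB : Metric I B) (gF : Metric J F) (f : B → ℝ)
    (hf : ContMDiff I 𝓘(ℝ, ℝ) ∞ f) (hpos : ∀ x, 0 < f x) (p : B × F) (v w : E × E') :
    (gB.warpedProduct gF f hf hpos).ricci p v w =
      gB.ricci p.1 v.1 w.1 - Module.finrank ℝ E' / f p.1 * gB.hess f p.1 v.1 w.1 +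
        gF.ricci p.2 v.2 w.2 - gF.val p.2 v.2 w.2 *
          (f p.1 * gB.laplacian f p.1 + (Module.finrank ℝ E' - 1) * gB.normSqGrad f p.1) := by
  have h := (gB.isWarpedAt_warpedProduct gF f hf hpos p).localRicci_eq v w
  rw [← laplacian_eq_trace, ← normSqGrad_eq gB hf, chartRep_self, Function.comp_apply,
    extChartAt_to_inv] at h
  exact h

theorem ricci_prod (g₁ : Metric I B) (g₂ : Metric J F) (p : B × F) (v w : E × E') :
    (g₁.prod g₂).ricci p v w = g₁.ricci p.1 v.1 w.1 + g₂.ricci p.2 v.2 w.2 := by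
  refine (g₁.ricci_warpedProduct g₂ _ _ _ p v w).trans ?_
  have h : g₁.hess (fun _ => 1) p.1 v.1 w.1 = 0 := by
    rw [hess_const]
    rfl
  rw [laplacian_eq_zero_of_hess_eq_zero _ (g₁.hess_const 1 p.1), normSqGrad_const, h]
  simp

theorem sharpAt_prod (g₁ : Metric I B) (g₂ : Metric J F) (p : B × F) (α : E × E' →L[ℝ] ℝ) :
    (g₁.prod g₂).sharpAt p α =
      ((g₁.sharpAt p.1 (α ∘L ContinuousLinearMap.inl ℝ E E') : E),
        (g₂.sharpAt p.2 (α ∘L ContinuousLinearMap.inr ℝ E E') : E')) := by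
  refine (g₁.prod g₂).ext_val p fun (w : E × E') => ?_
  refine ((g₁.prod g₂).val_sharpAt p α w).trans ?_
  refine Eq.trans ?_ (g₁.prod_apply g₂ p _ w).symm
  refine Eq.trans ?_ (congrArg₂ (· + ·) (g₁.val_sharpAt p.1 _ w.1) (g₂.val_sharpAt p.2 _ w.2)).symm
  change α w = α (w.1, 0) + α (0, w.2)
  rw [← map_add]
  simp

variable {f : B × F → ℝ} {f₁ : B → ℝ} {f₂ : F → ℝ}

theorem hess_prod (g₁ : Metric I B) (g₂ : Metric J F) (h₁ : ContMDiff I 𝓘(ℝ, ℝ) ∞ f₁)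
    (h₂ : ContMDiff J 𝓘(ℝ, ℝ) ∞ f₂) (hf : ∀ x y, f (x, y) = f₁ x + f₂ y) (p : B × F)
    (v w : E × E') :
    (g₁.prod g₂).hess f p v w = g₁.hess f₁ p.1 v.1 w.1 + g₂.hess f₂ p.2 v.2 w.2 := by
  obtain rfl : f = fun x => f₁ x.1 + f₂ x.2 := funext fun x => hf x.1 x.2
  exact (g₁.isWarpedAt_warpedProduct g₂ (fun _ => 1) contMDiff_const (fun _ => one_pos)
    p).localHess_add (contDiffAt_comp_symm h₁ p.1) (contDiffAt_comp_symm h₂ p.2) v w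

theorem laplacian_prod (g₁ : Metric I B) (g₂ : Metric J F) (h₁ : ContMDiff I 𝓘(ℝ, ℝ) ∞ f₁)
    (h₂ : ContMDiff J 𝓘(ℝ, ℝ) ∞ f₂) (hf : ∀ x y, f (x, y) = f₁ x + f₂ y) (p : B × F) :
    (g₁.prod g₂).laplacian f p = g₁.laplacian f₁ p.1 + g₂.laplacian f₂ p.2 := by
  have hh := g₁.hess_prod g₂ h₁ h₂ hf p
  refine (trace_prod (E := E) (E' := E') _).trans (congrArg₂ (· + ·) ?_ ?_)
  · refine congrArg (LinearMap.trace ℝ E) (LinearMap.ext fun u => ?_)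
    refine (congrArg Prod.fst (g₁.sharpAt_prod g₂ p _)).trans
      (congrArg (g₁.sharpAt p.1) (ContinuousLinearMap.ext fun w => ?_))
    exact (hh (u, 0) (w, 0)).trans
      ((congrArg (_ + ·) (map_zero (g₂.hess f₂ p.2 0))).trans (add_zero _))
  · refine congrArg (LinearMap.trace ℝ E') (LinearMap.ext fun u => ?_)
    refine (congrArg Prod.snd (g₁.sharpAt_prod g₂ p _)).trans
      (congrArg (g₂.sharpAt p.2) (ContinuousLinearMap.ext fun w => ?_))
    exact (hh (0, u) (0, w)).trans
      ((congrArg (· + _) (map_zero (g₁.hess f₁ p.1 0))).trans (zero_add _))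

theorem normSqGrad_prod (g₁ : Metric I B) (g₂ : Metric J F) (h₁ : ContMDiff I 𝓘(ℝ, ℝ) ∞ f₁)
    (h₂ : ContMDiff J 𝓘(ℝ, ℝ) ∞ f₂) (hf : ∀ x y, f (x, y) = f₁ x + f₂ y) (p : B × F) :
    (g₁.prod g₂).normSqGrad f p = g₁.normSqGrad f₁ p.1 + g₂.normSqGrad f₂ p.2 := by
  obtain rfl : f = fun x => f₁ x.1 + f₂ x.2 := funext fun x => hf x.1 x.2
  let α₁ : E →L[ℝ] ℝ := mfderiv I 𝓘(ℝ, ℝ) f₁ p.1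
  let α₂ : E' →L[ℝ] ℝ := mfderiv J 𝓘(ℝ, ℝ) f₂ p.2
  let α : E × E' →L[ℝ] ℝ :=
    α₁ ∘L ContinuousLinearMap.fst ℝ E E' + α₂ ∘L ContinuousLinearMap.snd ℝ E E'
  have hd : HasMFDerivAt (I.prod J) 𝓘(ℝ, ℝ) (fun x : B × F => f₁ x.1 + f₂ x.2) p α :=
    ((h₁.mdifferentiable (by simp) p.1).hasMFDerivAt.comp p (hasMFDerivAt_fst p)).add
      ((h₂.mdifferentiable (by simp) p.2).hasMFDerivAt.comp p (hasMFDerivAt_snd p))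
  have hg : (g₁.prod g₂).grad (fun x => f₁ x.1 + f₂ x.2) p =
      ((g₁.grad f₁ p.1 : E), (g₂.grad f₂ p.2 : E')) := by
    refine (congrArg ((g₁.prod g₂).sharpAt p) hd.mfderiv).trans
      ((g₁.sharpAt_prod g₂ p α).trans (Prod.ext ?_ ?_))
    · refine congrArg (g₁.sharpAt p.1) (ContinuousLinearMap.ext fun w => ?_)
      exact (congrArg (α₁ w + ·) (map_zero α₂)).trans (add_zero _)
    · refine congrArg (g₂.sharpAt p.2) (ContinuousLinearMap.ext fun w => ?_)
      exact (congrArg (· + α₂ w) (map_zero α₁)).trans (zero_add _)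
  rw [normSqGrad, hg]
  exact g₁.prod_apply g₂ p _ _

end Metric


end Product

end SemiRiem

/-! ### The Ricci tensor over a product base -/

theorem proposition1p1
    {E₁ : Type*} [NormedAddCommGroup E₁] [NormedSpace ℝ E₁] [FiniteDimensional ℝ E₁]
    {H₁ : Type*} [TopologicalSpace H₁] {I₁ : ModelWithCorners ℝ E₁ H₁} [I₁.Boundaryless]
    {B₁ : Type*} [TopologicalSpace B₁] [ChartedSpace H₁ B₁] [IsManifold I₁ ∞ B₁]
    {E₂ : Type*} [NormedAddCommGroup E₂] [NormedSpace ℝ E₂] [FiniteDimensional ℝ E₂]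
    {H₂ : Type*} [TopologicalSpace H₂] {I₂ : ModelWithCorners ℝ E₂ H₂} [I₂.Boundaryless]
    {B₂ : Type*} [TopologicalSpace B₂] [ChartedSpace H₂ B₂] [IsManifold I₂ ∞ B₂]
    {E₃ : Type*} [NormedAddCommGroup E₃] [NormedSpace ℝ E₃] [FiniteDimensional ℝ E₃]
    {H₃ : Type*} [TopologicalSpace H₃] {I₃ : ModelWithCorners ℝ E₃ H₃} [I₃.Boundaryless]
    {F : Type*} [TopologicalSpace F] [ChartedSpace H₃ F] [IsManifold I₃ ∞ F]
    -- the semi-Riemannian metrics of the three factors, and `d = dim F`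
    (g₁ : SemiRiem.Metric I₁ B₁) (g₂ : SemiRiem.Metric I₂ B₂) (gF : SemiRiem.Metric I₃ F)
    (d : ℕ) (hd : d = Module.finrank ℝ E₃)
    -- the smooth positive warping function `f (x, y) = f₁ x + f₂ y` on `B = B₁ × B₂`
    (f : B₁ × B₂ → ℝ) (hf : ContMDiff (I₁.prod I₂) 𝓘(ℝ, ℝ) ∞ f) (hpos : ∀ b, 0 < f b)
    (f₁ : B₁ → ℝ) (f₂ : B₂ → ℝ) (hsum : ∀ x y, f (x, y) = f₁ x + f₂ y)
    (hess₂ : ∀ y, g₂.hess f₂ y = 0)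
    -- the metric `g_B = g₁ + g₂` of `B` and the metric `g_M = g_B + f² g_F` of `M = B ×_f F`
    (gB : SemiRiem.Metric (I₁.prod I₂) (B₁ × B₂)) (hgB : gB = g₁.prod g₂)
    (gM : SemiRiem.Metric ((I₁.prod I₂).prod I₃) ((B₁ × B₂) × F))
    (hgM : gM = gB.warpedProduct gF f hf hpos) :
    -- the Hessian, the gradient and the Laplacian of `f` on `B`
    (∀ (x : B₁) (y : B₂) (v w : TangentSpace (I₁.prod I₂) (x, y)),
      gB.hess f (x, y) v w =
        g₁.hess f₁ x (mfderiv (I₁.prod I₂) I₁ Prod.fst (x, y) v)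
          (mfderiv (I₁.prod I₂) I₁ Prod.fst (x, y) w) +
        g₂.hess f₂ y (mfderiv (I₁.prod I₂) I₂ Prod.snd (x, y) v)
          (mfderiv (I₁.prod I₂) I₂ Prod.snd (x, y) w)) ∧
    (∀ (x : B₁) (y : B₂),
      gB.normSqGrad f (x, y) = g₁.normSqGrad f₁ x + g₂.normSqGrad f₂ y ∧
      gB.laplacian f (x, y) = g₁.laplacian f₁ x + g₂.laplacian f₂ y ∧
      g₂.laplacian f₂ y = 0) ∧
    -- the Ricci tensor of `M`, on vectors `X, X'`, `Y, Y'`, `U, U'` tangent to `B₁`, `B₂`, `F`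
    (∀ (x : B₁) (y : B₂) (q : F) (X X' : TangentSpace I₁ x) (Y Y' : TangentSpace I₂ y)
        (U U' : TangentSpace I₃ q),
      gM.ricci ((x, y), q) (SemiRiem.liftFst (SemiRiem.liftFst X))
          (SemiRiem.liftFst (SemiRiem.liftFst X')) =
        g₁.ricci x X X' - d / f (x, y) * g₁.hess f₁ x X X' ∧
      gM.ricci ((x, y), q) (SemiRiem.liftFst (SemiRiem.liftSnd Y))
          (SemiRiem.liftFst (SemiRiem.liftSnd Y')) =
        g₂.ricci y Y Y' ∧
      gM.ricci ((x, y), q) (SemiRiem.liftSnd U) (SemiRiem.liftSnd U') =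
        gF.ricci q U U' -
          gM.val ((x, y), q) (SemiRiem.liftSnd U) (SemiRiem.liftSnd U') *
            (g₁.laplacian f₁ x / f (x, y) +
              (d - 1) * (gB.normSqGrad f (x, y) / f (x, y) ^ 2)) ∧
      gM.ricci ((x, y), q) (SemiRiem.liftFst (SemiRiem.liftFst X))
          (SemiRiem.liftFst (SemiRiem.liftSnd Y)) = 0 ∧
      gM.ricci ((x, y), q) (SemiRiem.liftFst (SemiRiem.liftSnd Y))
          (SemiRiem.liftFst (SemiRiem.liftFst X)) = 0 ∧
      gM.ricci ((x, y), q) (SemiRiem.liftFst (SemiRiem.liftFst X)) (SemiRiem.liftSnd U) = 0 ∧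
      gM.ricci ((x, y), q) (SemiRiem.liftSnd U) (SemiRiem.liftFst (SemiRiem.liftFst X)) = 0 ∧
      gM.ricci ((x, y), q) (SemiRiem.liftFst (SemiRiem.liftSnd Y)) (SemiRiem.liftSnd U) = 0 ∧
      gM.ricci ((x, y), q) (SemiRiem.liftSnd U) (SemiRiem.liftFst (SemiRiem.liftSnd Y)) = 0) := by
  -- `f₁` and `f₂` are smooth: on the slices `B₁ × {y}` and `{x} × B₂` they differ from `f` by a
  -- constant, if there is such a slice
  have hf₁ [Nonempty B₂] : ContMDiff I₁ 𝓘(ℝ, ℝ) ∞ f₁ := by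
    obtain ⟨y⟩ := ‹Nonempty B₂›
    have h : f₁ = fun x => f (x, y) - f₂ y := funext fun x => by rw [hsum]; ring
    rw [h]
    exact (hf.comp (contMDiff_id.prodMk contMDiff_const)).sub contMDiff_const
  have hf₂ [Nonempty B₁] : ContMDiff I₂ 𝓘(ℝ, ℝ) ∞ f₂ := by
    obtain ⟨x⟩ := ‹Nonempty B₁›
    have h : f₂ = fun y => f (x, y) - f₁ x := funext fun y => by rw [hsum]; ring
    rw [h]
    exact (hf.comp (contMDiff_const.prodMk contMDiff_id)).sub contMDiff_const
  subst hgB hgM hd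
  have hlap₂ (y : B₂) : g₂.laplacian f₂ y = 0 :=
    SemiRiem.Metric.laplacian_eq_zero_of_hess_eq_zero g₂ (hess₂ y)
  -- the vectors are taken in the model spaces, to which the tangent spaces unfold, so that they can
  -- be put together with the zero vectors of the other factors
  refine ⟨fun x y v w => ?_, fun x y => ?_, fun x y q (X X' : E₁) (Y Y' : E₂)
    (U U' : E₃) => ?_⟩
  · have : Nonempty B₁ := ⟨x⟩
    have : Nonempty B₂ := ⟨y⟩
    rw [mfderiv_fst, mfderiv_snd]
    exact g₁.hess_prod g₂ hf₁ hf₂ hsum (x, y) v w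
  · have : Nonempty B₁ := ⟨x⟩
    have : Nonempty B₂ := ⟨y⟩
    exact ⟨g₁.normSqGrad_prod g₂ hf₁ hf₂ hsum (x, y), g₁.laplacian_prod g₂ hf₁ hf₂ hsum (x, y),
      hlap₂ y⟩
  · have : Nonempty B₁ := ⟨x⟩
    have : Nonempty B₂ := ⟨y⟩
    have hne := (hpos (x, y)).ne'
    have hlap : (g₁.prod g₂).laplacian f (x, y) = g₁.laplacian f₁ x :=
      (g₁.laplacian_prod g₂ hf₁ hf₂ hsum (x, y)).trans (by rw [hlap₂, add_zero])
    have hhess (v w : E₁ × E₂) : (g₁.prod g₂).hess f (x, y) v w = g₁.hess f₁ x v.1 w.1 := by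
      refine (g₁.hess_prod g₂ hf₁ hf₂ hsum (x, y) v w).trans ?_
      rw [hess₂]
      exact add_zero _
    -- the Ricci tensor of `M` on arbitrary pairs of vectors, in terms of the three factors
    have key (v w : (E₁ × E₂) × E₃) := (g₁.prod g₂).ricci_warpedProduct gF f hf hpos ((x, y), q) v w
    simp only [hlap, hhess, g₁.ricci_prod g₂] at key
    have h₁l (a : E₁) : g₁.hess f₁ x (0 : E₁) a = 0 :=
      DFunLike.congr_fun (map_zero (g₁.hess f₁ x)) a
    have h₁r (a : E₁) : g₁.hess f₁ x a (0 : E₁) = 0 := map_zero (g₁.hess f₁ x a)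
    have hFl (a : E₃) : gF.val q (0 : E₃) a = 0 := DFunLike.congr_fun (map_zero (gF.val q)) a
    have hFr (a : E₃) : gF.val q a (0 : E₃) = 0 := map_zero (gF.val q a)
    have hval : ((g₁.prod g₂).warpedProduct gF f hf hpos).val ((x, y), q)
        (SemiRiem.liftSnd U) (SemiRiem.liftSnd U') = f (x, y) ^ 2 * gF.val q U U' := by
      refine ((g₁.prod g₂).warpedProduct_apply gF f hf hpos ((x, y), q) _ _).trans ?_
      exact (congrArg (· + _) (map_zero ((g₁.prod g₂).val (x, y) 0))).trans (zero_add _)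
    refine ⟨(key ((X, 0), 0) ((X', 0), 0)).trans ?_, (key ((0, Y), 0) ((0, Y'), 0)).trans ?_,
      (key (0, U) (0, U')).trans ?_, (key ((X, 0), 0) ((0, Y), 0)).trans ?_,
      (key ((0, Y), 0) ((X, 0), 0)).trans ?_, (key ((X, 0), 0) (0, U)).trans ?_,
      (key (0, U) ((X, 0), 0)).trans ?_, (key ((0, Y), 0) (0, U)).trans ?_,
      (key (0, U) ((0, Y), 0)).trans ?_⟩
    case refine_3 =>
      simp only [hval, Prod.fst_zero, Prod.snd_zero, SemiRiem.Metric.ricci_zero_left, h₁l]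
      field_simp
      ring
    all_goals
      simp only [Prod.fst_zero, Prod.snd_zero, SemiRiem.Metric.ricci_zero_left,
        SemiRiem.Metric.ricci_zero_right, h₁l, h₁r, hFl, hFr]
      ring
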